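/- Let $\mathbb{S}^3=\{(z_1,z_2)\in\mathbb{C}^2 : |z_1|^2+|z_2|^2=1\}$ carry the round metric. A smooth tangent vector field $u$ on $\mathbb{S}^3$ is a steady Euler field with (smooth) pressure $p$ if $\nabla_u u=-\mathrm{grad}\,p$ and $\mathrm{div}\,u=0$; its Bernoulli function is $b=p+\tfrac12|u|^2$. It is a Beltrami field if $\mathrm{div}\,u=0$ and $\mathrm{curl}\,u=\theta u$ for some smooth function $\theta$. Write points of $\mathbb{S}^3$ as $(\cos s\,e^{i\phi_1},\sin s\,e^{i\phi_2})$ and let $\xi=\partial_{\phi_1}+\partial_{\phi_2}$, $\xi'=\partial_{\phi_1}-\partial_{\phi_2}$ be the Hopf and anti-Hopf fields. The KKPS fields are the fields $u=A(\cos^2 s)\,\xi+B(\cos^2 s)\,\xi'$ with smooth $A,B:\mathbb{R}\to\mathbb{R}$; all of them are steady Euler fields. Put $\|w\|_{C^k}=\sum_{i=0}^k\sup_{\mathbb{S}^3}|\nabla^i w|$. Two fields $u,v$ are related by an isometry $\varphi$ of $\mathbb{S}^3$ if $\mathrm{d}\varphi(u)=v\circ\varphi$. Theorem. The family of KKPS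 fields on $\mathbb{S}^3$ is not isolated among the steady Euler fields. More precisely: 1. There is a KKPS field $u_0$ with non-constant Bernoulli function such that for every integer $k\ge 0$ and every $\varepsilon>0$ there is a steady Euler field $u$ with non-constant Bernoulli function such that $\|u-u_0\|_{C^k}<\varepsilon$ and $u$ is not related by any isometry of $\mathbb{S}^3$ to any KKPS field (in particular $u$ is not a KKPS field). 2. There is a KKPS field $u_0\not\equiv 0$ that is a Beltrami field such that for every integer $k\ge 0$ and every $\varepsilon>0$ there is a Beltrami field $u$ (a steady Euler field with constant Bernoulli function) such that $\|u-u_0\|_{C^k}<\varepsilon$ and $u$ is not related by any isometry of $\mathbb{S}^3$ to any KKPS field. -/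

import Mathlib

open scoped Manifold ContDiff ENNReal

noncomputable section

/-- Euclidean space `ℝ⁴ = ℂ²`, with coordinates `(x₁, y₁, x₂, y₂) = (x 0, x 1, x 2, x 3)`. -/
abbrev E4 : Type := EuclideanSpace ℝ (Fin 4)

instance factFinrankE4 : Fact (Module.finrank ℝ E4 = 3 + 1) := ⟨by simp⟩

/-- The unit sphere `𝕊³ ⊂ ℝ⁴`; it carries Mathlib's smooth structure (modelled on `𝓡 3`). Its
tangent space at `x` is identified with `{v : E4 | ⟪x, v⟫ = 0}`, and the round metric is the
restriction of the inner product of `E4`. -/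
abbrev S3 : Type := Metric.sphere (0 : E4) 1

namespace S3

/-- The radial retraction `y ↦ y / ‖y‖` of `ℝ⁴ ∖ {0}` onto the sphere (with a dummy value at `0`). -/
def retract (y : E4) : S3 :=
  if h : y = 0 then ⟨EuclideanSpace.single 0 1, by simp⟩
  else ⟨‖y‖⁻¹ • y, by simp [norm_smul, h]⟩

theorem retract_coe (x : S3) : retract (x : E4) = x := by
  have hx : ‖(x : E4)‖ = 1 := by simp
  have h : (x : E4) ≠ 0 := by
    intro h0
    rw [h0] at hx
    simp at hx
  apply Subtype.ext
  simp [retract, h]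

/-- The differential at `x` of a map `f` on the sphere with values in a normed space: the Fréchet
derivative at `x` of the extension `y ↦ f (y / ‖y‖)` of `f`. On tangent vectors at `x` it is the
usual differential of `f`, and it vanishes on the normal vector `x`. -/
def differential {F : Type*} [NormedAddCommGroup F] [NormedSpace ℝ F] (f : S3 → F) (x : S3) :
    E4 →L[ℝ] F :=
  fderiv ℝ (fun y : E4 => f (retract y)) (x : E4)

/-- The orthogonal projection `v ↦ v - ⟪x, v⟫ x` of `ℝ⁴` onto the tangent space at `x`. -/
def tanProj (x : S3) : E4 →L[ℝ] E4 :=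
  ContinuousLinearMap.id ℝ E4 - (innerSL ℝ (x : E4)).smulRight (x : E4)

/-- Smooth tangent vector fields on the sphere. -/
def IsVectorField (u : S3 → E4) : Prop :=
  ContMDiff (𝓡 3) 𝓘(ℝ, E4) ∞ u ∧ ∀ x : S3, inner ℝ (x : E4) (u x) = 0

/-- The Levi-Civita derivative of the round metric, `covDeriv u x v = (∇_v u)(x)`: the tangential
part of the ambient derivative. -/
def covDeriv (u : S3 → E4) (x : S3) : E4 →L[ℝ] E4 :=
  (tanProj x).comp (differential u x)

/-- The Riemannian gradient of a function. -/
def grad (f : S3 → ℝ) (x : S3) : E4 :=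
  (InnerProductSpace.toDual ℝ E4).symm (differential f x)

/-- The divergence, i.e. the trace of `v ↦ ∇_v u`; the normal direction contributes `0`. -/
def divergence (u : S3 → E4) (x : S3) : ℝ :=
  LinearMap.trace ℝ E4 (covDeriv u x : E4 →ₗ[ℝ] E4)

/-- The cross product on the oriented Euclidean space `T_x 𝕊³`, determined by
`⟪a × b, c⟫ = det (x, a, b, c)` (the sphere is oriented by its outward normal). -/
def cross (x : S3) (a b : E4) : E4 :=
  WithLp.toLp 2 fun j : Fin 4 =>
    Matrix.det (Matrix.of ![(fun i => (x : E4) i), (fun i => a i), (fun i => b i),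
      (Pi.single j 1 : Fin 4 → ℝ)])

/-- The curl `(∗ d u♭)♯ = ∑ e_i × ∇_{e_i} u`. The sum does not depend on the orthonormal basis of
`ℝ⁴`, and for a basis that is adapted to `x` the normal direction contributes `0`. -/
def curl (u : S3 → E4) (x : S3) : E4 :=
  ∑ i : Fin 4, cross x (EuclideanSpace.single i 1) (covDeriv u x (EuclideanSpace.single i 1))

/-- `u` is a steady Euler field with pressure `p`: `∇_u u = - grad p` and `div u = 0`. -/
def IsSteadyEuler (u : S3 → E4) (p : S3 → ℝ) : Prop :=
  IsVectorField u ∧ ContMDiff (𝓡 3) 𝓘(ℝ, ℝ) ∞ p ∧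
    (∀ x : S3, covDeriv u x (u x) = - grad p x) ∧ ∀ x : S3, divergence u x = 0

/-- The Bernoulli function `b = p + |u|² / 2`. -/
def bernoulli (u : S3 → E4) (p : S3 → ℝ) (x : S3) : ℝ := p x + ‖u x‖ ^ 2 / 2

/-- The function is constant. -/
def IsConstant (b : S3 → ℝ) : Prop := ∃ c : ℝ, ∀ x : S3, b x = c

/-- Beltrami fields: divergence-free fields that are aligned with their own curl. -/
def IsBeltrami (u : S3 → E4) : Prop :=
  IsVectorField u ∧ (∀ x : S3, divergence u x = 0) ∧
    ∃ θ : S3 → ℝ, ContMDiff (𝓡 3) 𝓘(ℝ, ℝ) ∞ θ ∧ ∀ x : S3, curl u x = θ x • u x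

/-- The Hopf field `ξ = ∂_{φ₁} + ∂_{φ₂}`. -/
def hopf (x : S3) : E4 := !₂[-(x : E4) 1, (x : E4) 0, -(x : E4) 3, (x : E4) 2]

/-- The anti-Hopf field `ξ' = ∂_{φ₁} - ∂_{φ₂}`. -/
def antiHopf (x : S3) : E4 := !₂[-(x : E4) 1, (x : E4) 0, (x : E4) 3, -(x : E4) 2]

/-- The first integral `cos² s = |z₁|²` at the point `(cos s e^{iφ₁}, sin s e^{iφ₂})`. -/
def cosSq (x : S3) : ℝ := (x : E4) 0 ^ 2 + (x : E4) 1 ^ 2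

/-- KKPS fields: `u = A(cos² s) ξ + B(cos² s) ξ'` with smooth `A` and `B`. -/
def IsKKPS (u : S3 → E4) : Prop :=
  ∃ A B : ℝ → ℝ, ContDiff ℝ ∞ A ∧ ContDiff ℝ ∞ B ∧
    ∀ x : S3, u x = A (cosSq x) • hopf x + B (cosSq x) • antiHopf x

/-- The differential at `x` of a self-diffeomorphism of the sphere (on tangent vectors at `x`). -/
def diffeoDifferential (φ : S3 ≃ₘ^∞⟮𝓡 3, 𝓡 3⟯ S3) (x : S3) : E4 →L[ℝ] E4 :=
  differential (fun y : S3 => (φ y : E4)) x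

/-- Isometries of the round sphere: diffeomorphisms that preserve the Riemannian metric. -/
def IsIsometry (φ : S3 ≃ₘ^∞⟮𝓡 3, 𝓡 3⟯ S3) : Prop :=
  ∀ (x : S3) (v w : E4), inner ℝ (x : E4) v = 0 → inner ℝ (x : E4) w = 0 →
    inner ℝ (diffeoDifferential φ x v) (diffeoDifferential φ x w) = inner ℝ v w

/-- `u` and `v` are related by an isometry `φ`: `dφ(u) = v ∘ φ`. -/
def IsometricallyRelated (u v : S3 → E4) : Prop :=
  ∃ φ : S3 ≃ₘ^∞⟮𝓡 3, 𝓡 3⟯ S3, IsIsometry φ ∧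
    ∀ x : S3, diffeoDifferential φ x (u x) = v (φ x)

/-- The iterated covariant derivative `∇^k u`, a tensor field with `k` tangent arguments and
tangent values, extended by `0` to normal arguments: one more covariant derivative of a tensor
field is the tangential part (in all arguments and in the value) of its ambient derivative. -/
def iterCovDeriv (u : S3 → E4) : (k : ℕ) → S3 → E4 [×k]→L[ℝ] E4
  | 0 => fun x => ContinuousMultilinearMap.uncurry0 ℝ E4 (u x)
  | k + 1 => fun x =>
      (tanProj x).compContinuousMultilinearMap
        (((differential (iterCovDeriv u k) x).uncurryLeft).compContinuousLinearMap
          fun _ => tanProj x)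

/-- The `C^k` norm `∑_{i ≤ k} sup |∇^i w|`, as an extended nonnegative real. -/
def ckNorm (k : ℕ) (w : S3 → E4) : ℝ≥0∞ :=
  ∑ i ∈ Finset.range (k + 1), ⨆ x : S3, ‖iterCovDeriv w i x‖ₑ

end S3

end

noncomputable section

namespace S3

/-! The anti-Hopf field ξ₃ = ξ' belongs to an orthonormal frame ξ₁, ξ₂, ξ₃ of linear fields on the
sphere. Let hᵢ = ⟨ξᵢ, ξ⟩ be the components of the Hopf map, so that ξ = ∑ hᵢ ξᵢ. The fields u = a
h₁ξ₁ + b h₂ξ₂ + c h₃ξ₃ (`cubicField`) are all steady Euler, with Bernoulli function (a+b+c)/2 · (a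
h₁² + b h₂² + c h₃²). If a+b+c = 0 they are Beltrami with curl u = -4u. If a = b they are KKPS.

Along u the hᵢ evolve like the angular momentum of a rigid body, and the derivative of |u|² = a²h₁²
+ b²h₂² + c²h₃² is a nonzero multiple of (a-b)(b-c)(a-c) h₁h₂h₃. The speed of a KKPS field depends
only on cos² s, hence is a first integral, and isometries preserve this property
(`differential_normSq_eq_zero`). So for distinct a, b, c the field is related to no KKPS field
(`not_related_isKKPS_cubicField`). Moving (a, a, c) slightly to distinct parameters proves both
claims; the perturbation is δ times a fixed smooth field, so it is small in every C^k norm. -/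

/-! ### Calculus on the sphere through the radial retraction. -/

theorem norm_coe (x : S3) : ‖(x : E4)‖ = 1 := by simp

theorem coe_ne_zero (x : S3) : (x : E4) ≠ 0 := by
  intro h
  have := norm_coe x
  simp [h] at this

theorem coe_retract {y : E4} (hy : y ≠ 0) : (retract y : E4) = ‖y‖⁻¹ • y := by
  simp [retract, hy]

theorem eventually_coe_retract {y : E4} (hy : y ≠ 0) :
    (fun y : E4 => (retract y : E4)) =ᶠ[nhds y] fun y => ‖y‖⁻¹ • y := by
  filter_upwards [isOpen_compl_singleton.mem_nhds hy] with z hz using coe_retract hz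

theorem contDiffAt_coe_retract {y : E4} (hy : y ≠ 0) {n : WithTop ℕ∞} :
    ContDiffAt ℝ n (fun y : E4 => (retract y : E4)) y :=
  (((contDiffAt_norm ℝ hy).inv (norm_ne_zero_iff.2 hy)).smul contDiffAt_id).congr_of_eventuallyEq
    (eventually_coe_retract hy)

theorem hasFDerivAt_coe_retract (x : S3) :
    HasFDerivAt (fun y : E4 => (retract y : E4)) (tanProj x) (x : E4) := by
  have hx := coe_ne_zero x
  have h1 : HasFDerivAt (fun y : E4 => ‖y‖ ^ 2) (2 • innerSL ℝ (x : E4)) (x : E4) :=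
    (hasStrictFDerivAt_norm_sq (x : E4)).hasFDerivAt
  have h2 := (hasDerivAt_inv (x := √(‖(x : E4)‖ ^ 2)) (by simp)).comp_hasFDerivAt (x : E4)
    (h1.sqrt (by simp))
  have h3 := h2.smul (hasFDerivAt_id (𝕜 := ℝ) (x : E4))
  have h4 : ((fun y : ℝ => y⁻¹) ∘ fun y : E4 => √(‖y‖ ^ 2)) • id = fun y : E4 => ‖y‖⁻¹ • y := by
    funext y
    simp
  rw [h4] at h3
  refine (h3.congr_fderiv ?_).congr_of_eventuallyEq (eventually_coe_retract hx)
  ext1 v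
  simp [tanProj, sub_eq_add_neg, ← smul_assoc]

/-- The differential of the restriction of an ambient map. -/
theorem differential_comp_coe {F : Type*} [NormedAddCommGroup F] [NormedSpace ℝ F] {f : E4 → F}
    {f' : E4 →L[ℝ] F} {x : S3} (hf : HasFDerivAt f f' (x : E4)) :
    differential (fun y : S3 => f y) x = f'.comp (tanProj x) := by
  rw [← retract_coe x] at hf
  have := hf.comp (x : E4) (hasFDerivAt_coe_retract x)
  exact this.fderiv

theorem contMDiffAt_retract {y : E4} (hy : y ≠ 0) :
    ContMDiffAt 𝓘(ℝ, E4) (𝓡 3) ∞ retract y := by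
  -- Restricting the codomain to the sphere needs a globally smooth map, hence the passage to the
  -- punctured space.
  let U : TopologicalSpace.Opens E4 := ⟨{0}ᶜ, isOpen_compl_singleton⟩
  let y' : U := ⟨y, hy⟩
  have h : ContMDiff 𝓘(ℝ, E4) 𝓘(ℝ, E4) ∞ fun z : U => (retract (z : E4) : E4) := fun z =>
    contMDiffAt_subtype_iff.2 (contDiffAt_coe_retract z.2).contMDiffAt
  have h' := h.codRestrict_sphere (n := 3) fun z => (retract (z : E4)).2
  exact contMDiffAt_subtype_iff (x := y').1 (h' y')

theorem differentiableAt_diffeo (φ : S3 ≃ₘ^∞⟮𝓡 3, 𝓡 3⟯ S3) (x : S3) :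
    DifferentiableAt ℝ (fun y : E4 => (φ (retract y) : E4)) (x : E4) := by
  have h1 : ContMDiff (𝓡 3) 𝓘(ℝ, E4) ∞ fun y : S3 => (φ y : E4) :=
    contMDiff_coe_sphere.comp φ.contMDiff
  have h2 : ContMDiffAt 𝓘(ℝ, E4) 𝓘(ℝ, E4) ∞ (fun y : E4 => (φ (retract y) : E4)) (x : E4) :=
    (h1 _).comp (x : E4) (contMDiffAt_retract (coe_ne_zero x))
  exact h2.contDiffAt.differentiableAt (by simp)

theorem differential_comp_diffeo {f : E4 → ℝ} (φ : S3 ≃ₘ^∞⟮𝓡 3, 𝓡 3⟯ S3) (x : S3)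
    (hf : DifferentiableAt ℝ f (φ x)) (v : E4) :
    differential (fun y : S3 => f (φ y)) x v = fderiv ℝ f (φ x) (diffeoDifferential φ x v) := by
  have hφ := (differentiableAt_diffeo φ x).hasFDerivAt
  have hf' : HasFDerivAt f (fderiv ℝ f (φ x)) (φ (retract (x : E4)) : E4) := by
    rw [retract_coe]
    exact hf.hasFDerivAt
  have := (hf'.comp (x : E4) hφ).fderiv
  exact congrArg (fun L : E4 →L[ℝ] ℝ => L v) this

/-! ### The isometry invariant that excludes KKPS fields. -/

/-- The speed of a field that is related to a KKPS field is a first integral of it. -/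
theorem differential_normSq_eq_zero {u v : S3 → E4} (hu : ∀ x : S3, inner ℝ (x : E4) (u x) = 0)
    (hv : IsKKPS v) (h : IsometricallyRelated u v) (x : S3) :
    differential (fun y => ‖u y‖ ^ 2) x (u x) = 0 := by
  obtain ⟨A, B, hA, hB, hv⟩ := hv
  obtain ⟨φ, hφ, hrel⟩ := h
  have hA' : Differentiable ℝ A := hA.differentiable (by simp)
  have hB' : Differentiable ℝ B := hB.differentiable (by simp)
  -- ξ and ξ' are unit fields with ⟨ξ, ξ'⟩ = cos² s - sin² s = 2t - 1, where t = cos² s.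
  let G : ℝ → ℝ := fun t => A t ^ 2 + B t ^ 2 + 2 * (A t * B t) * (2 * t - 1)
  have hG : Differentiable ℝ G := by fun_prop
  have hq : ∀ y : E4, HasFDerivAt (fun y : E4 => y 0 ^ 2 + y 1 ^ 2)
      ((2 * y 0) • EuclideanSpace.proj (𝕜 := ℝ) (0 : Fin 4) +
        (2 * y 1) • EuclideanSpace.proj (𝕜 := ℝ) (1 : Fin 4)) y := fun y => by
    have h0 : HasFDerivAt (fun y : E4 => y 0) (EuclideanSpace.proj (𝕜 := ℝ) (0 : Fin 4)) y :=
      (EuclideanSpace.proj (𝕜 := ℝ) (0 : Fin 4)).hasFDerivAt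
    have h1 : HasFDerivAt (fun y : E4 => y 1) (EuclideanSpace.proj (𝕜 := ℝ) (1 : Fin 4)) y :=
      (EuclideanSpace.proj (𝕜 := ℝ) (1 : Fin 4)).hasFDerivAt
    refine HasFDerivAt.congr_fderiv (f := fun y : E4 => y 0 ^ 2 + y 1 ^ 2)
      ((h0.pow 2).add (h1.pow 2)) (by simp)
  have hsq : ∀ y : S3, ‖v y‖ ^ 2 = G (cosSq y) := fun y => by
    have hy : ‖(y : E4)‖ ^ 2 = 1 := by rw [norm_coe, one_pow]
    rw [EuclideanSpace.real_norm_sq_eq, Fin.sum_univ_four] at hy ⊢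
    simp only [hv, G, hopf, antiHopf, cosSq]
    simp
    linear_combination (A ((y : E4) 0 ^ 2 + (y : E4) 1 ^ 2) -
      B ((y : E4) 0 ^ 2 + (y : E4) 1 ^ 2)) ^ 2 * hy
  have hw : (fun y => ‖u y‖ ^ 2) =
      fun y : S3 => (fun z : E4 => G (z 0 ^ 2 + z 1 ^ 2)) (φ y) := by
    funext y
    have := hφ y (u y) (u y) (hu y) (hu y)
    rw [hrel, real_inner_self_eq_norm_sq, real_inner_self_eq_norm_sq] at this
    rw [← this, hsq]
    rfl
  have hd := ((hG _).hasDerivAt.comp_hasFDerivAt (φ x : E4) (hq (φ x)))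
  rw [hw, differential_comp_diffeo φ x (f := fun z : E4 => G (z 0 ^ 2 + z 1 ^ 2))
    hd.differentiableAt]
  have hd' : fderiv ℝ (fun z : E4 => G (z 0 ^ 2 + z 1 ^ 2)) (φ x) = _ := hd.fderiv
  -- What remains is the derivative of cos² s along ξ and ξ', which vanishes.
  rw [hd', hrel, hv]
  simp [hopf, antiHopf]
  ring

/-! ### Tangential projection, and finiteness and scaling of the C^k norms. -/

theorem tanProj_apply (x : S3) (v : E4) :
    tanProj x v = v - inner ℝ (x : E4) v • (x : E4) := by
  simp [tanProj]

theorem inner_tanProj (x : S3) (v : E4) : inner ℝ (x : E4) (tanProj x v) = 0 := by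
  simp [tanProj_apply, inner_sub_right, inner_smul_right]

theorem inner_tanProj_left (x : S3) (v w : E4) :
    inner ℝ (tanProj x v) w = inner ℝ v (tanProj x w) := by
  simp only [tanProj_apply, inner_sub_left, inner_sub_right, inner_smul_left, inner_smul_right,
    real_inner_comm v, conj_trivial]
  ring

theorem tanProj_eq_self {x : S3} {v : E4} (h : inner ℝ (x : E4) v = 0) : tanProj x v = v := by
  simp [tanProj_apply, h]

theorem contDiff_tanProj_ext {n : WithTop ℕ∞} : ContDiff ℝ n fun y : E4 =>
    ContinuousLinearMap.id ℝ E4 - (innerSL ℝ y).smulRight y := by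
  have h := (ContinuousLinearMap.smulRightL ℝ E4 E4).isBoundedBilinearMap.contDiff (n := n)
  exact contDiff_const.sub (h.comp ((innerSL ℝ (E := E4)).contDiff.prodMk contDiff_id))

theorem contDiffAt_tanProj_retract {y : E4} (hy : y ≠ 0) {n : WithTop ℕ∞} :
    ContDiffAt ℝ n (fun y : E4 => tanProj (retract y)) y :=
  contDiff_tanProj_ext.contDiffAt.comp y (contDiffAt_coe_retract hy)

/-- Smoothness of a map on the sphere, in terms of its radial extension. -/
def RadiallySmooth {F : Type*} [NormedAddCommGroup F] [NormedSpace ℝ F] (f : S3 → F) : Prop :=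
  ∀ y : E4, y ≠ 0 → ContDiffAt ℝ ∞ (fun y : E4 => f (retract y)) y

/-- The derivative is evaluated on the sphere only and then extended radially again, so the class is
closed under iteration. -/
theorem RadiallySmooth.differential {F : Type*} [NormedAddCommGroup F] [NormedSpace ℝ F]
    {f : S3 → F} (hf : RadiallySmooth f) : RadiallySmooth (differential f) := fun y hy => by
  have h := (hf (retract y : E4) (coe_ne_zero _)).fderiv_right (m := ∞) (by simp)
  exact h.comp y (contDiffAt_coe_retract hy)

theorem RadiallySmooth.continuous {F : Type*} [NormedAddCommGroup F] [NormedSpace ℝ F]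
    {f : S3 → F} (hf : RadiallySmooth f) : Continuous f := by
  rw [continuous_iff_continuousAt]
  intro x
  have h := (hf x (coe_ne_zero x)).continuousAt.comp
    (continuous_subtype_val (p := fun y : E4 => y ∈ Metric.sphere (0 : E4) 1)).continuousAt
  refine h.congr (Filter.Eventually.of_forall fun y => ?_)
  simp [retract_coe]

theorem RadiallySmooth.iterCovDeriv {u : S3 → E4} (hu : RadiallySmooth u) (k : ℕ) :
    RadiallySmooth (iterCovDeriv u k) := by
  induction k with
  | zero =>
    intro y hy
    exact (continuousMultilinearCurryFin0 ℝ E4 E4).symm.contDiff.contDiffAt.comp y (hu y hy)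
  | succ k ih =>
    intro y hy
    have hP := contDiffAt_tanProj_retract hy (n := ∞)
    have h1 := (continuousMultilinearCurryLeftEquiv ℝ (fun _ : Fin (k + 1) => E4)
      E4).symm.contDiff.contDiffAt.comp y (ih.differential y hy)
    -- Precomposition is multilinear in the family of projections, hence smooth in it.
    have h2 := (ContinuousMultilinearMap.contDiff (𝕜 := ℝ) (n := ∞)
      (E := fun _ : Fin (k + 1) => E4 →L[ℝ] E4)
      (F := (E4 [×(k + 1)]→L[ℝ] E4) →L[ℝ] (E4 [×(k + 1)]→L[ℝ] E4))
      (ContinuousMultilinearMap.compContinuousLinearMapContinuousMultilinear ℝ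
        (fun _ : Fin (k + 1) => E4) (fun _ => E4) E4)).contDiffAt.comp y
        (contDiffAt_pi.2 fun _ => hP)
    have h3 := h2.clm_apply h1
    have h4 := (ContinuousLinearMap.contDiff (𝕜 := ℝ) (n := ∞) (E := E4 →L[ℝ] E4)
      (F := (E4 [×(k + 1)]→L[ℝ] E4) →L[ℝ] (E4 [×(k + 1)]→L[ℝ] E4))
      (ContinuousLinearMap.compContinuousMultilinearMapL ℝ
        (fun _ : Fin (k + 1) => E4) E4 E4)).contDiffAt.comp y hP
    exact h4.clm_apply h3

theorem ckNorm_ne_top {u : S3 → E4} (hu : RadiallySmooth u) (k : ℕ) : ckNorm k u ≠ ⊤ := by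
  refine ENNReal.sum_ne_top.2 fun i _ => ?_
  obtain ⟨C, hC⟩ := isCompact_univ.exists_bound_of_continuousOn
    (hu.iterCovDeriv i).continuous.continuousOn
  refine ne_top_of_le_ne_top ENNReal.ofReal_ne_top (b := ENNReal.ofReal C) (iSup_le fun x => ?_)
  rw [← ofReal_norm]
  exact ENNReal.ofReal_le_ofReal (hC x trivial)

theorem iterCovDeriv_smul (c : ℝ) (u : S3 → E4) (k : ℕ) :
    iterCovDeriv (c • u) k = c • iterCovDeriv u k := by
  induction k with
  | zero => rfl
  | succ k ih =>
    funext x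
    have h : differential (c • iterCovDeriv u k) x = c • differential (iterCovDeriv u k) x :=
      congrFun (fderiv_const_smul_field (𝕜 := ℝ)
        (f := fun y : E4 => iterCovDeriv u k (retract y)) c) (x : E4)
    simp only [iterCovDeriv, ih, h, Pi.smul_apply]
    ext v
    simp

theorem ckNorm_smul (c : ℝ) (u : S3 → E4) (k : ℕ) : ckNorm k (c • u) = ‖c‖ₑ * ckNorm k u := by
  simp only [ckNorm, iterCovDeriv_smul, Pi.smul_apply, enorm_smul, Finset.mul_sum, ENNReal.mul_iSup]

theorem exists_pos_ckNorm_smul_lt {u : S3 → E4} (hu : RadiallySmooth u) (k : ℕ) {ε : ℝ}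
    (hε : 0 < ε) : ∃ δ : ℝ, 0 < δ ∧ δ < 1 ∧ ckNorm k (δ • u) < ENNReal.ofReal ε := by
  set C := (ckNorm k u).toReal with hC
  have hC0 : 0 ≤ C := ENNReal.toReal_nonneg
  -- The bound δ < 1 later keeps the perturbed parameters distinct; C + 1 avoids dividing by zero.
  refine ⟨min (1 / 2) (ε / (C + 1) / 2), by positivity, by
    exact lt_of_le_of_lt (min_le_left _ _) (by norm_num), ?_⟩
  set δ := min (1 / 2) (ε / (C + 1) / 2) with hδ
  have hδ0 : 0 < δ := by positivity
  rw [ckNorm_smul, ← ofReal_norm, Real.norm_of_nonneg hδ0.le,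
    ← ENNReal.ofReal_toReal (ckNorm_ne_top hu k), ← ENNReal.ofReal_mul hδ0.le,
    ENNReal.ofReal_lt_ofReal_iff hε, ← hC]
  calc δ * C ≤ ε / (C + 1) / 2 * (C + 1) := by
        gcongr
        · exact min_le_right _ _
        · linarith
    _ < ε := by
        rw [div_right_comm, div_mul_cancel₀ _ (by positivity)]
        linarith

/-! ### The cubic fields and their derivatives. -/

/-- The linear field `(z₁, z₂) ↦ (z₂, -z₁)`. -/
def rotation₁ : E4 →L[ℝ] E4 := LinearMap.toContinuousLinearMap
  { toFun := fun y => !₂[y 2, y 3, -y 0, -y 1]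
    map_add' := fun y z => by ext i; fin_cases i <;> simp <;> ring
    map_smul' := fun c y => by ext i; fin_cases i <;> simp }

/-- The linear field `(z₁, z₂) ↦ (i z₂, i z₁)`. -/
def rotation₂ : E4 →L[ℝ] E4 := LinearMap.toContinuousLinearMap
  { toFun := fun y => !₂[-y 3, y 2, -y 1, y 0]
    map_add' := fun y z => by ext i; fin_cases i <;> simp <;> ring
    map_smul' := fun c y => by ext i; fin_cases i <;> simp }

/-- The linear field `(z₁, z₂) ↦ (i z₁, -i z₂)`, which extends the anti-Hopf field. -/
def rotation₃ : E4 →L[ℝ] E4 := LinearMap.toContinuousLinearMap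
  { toFun := fun y => !₂[-y 1, y 0, y 3, -y 2]
    map_add' := fun y z => by ext i; fin_cases i <;> simp <;> ring
    map_smul' := fun c y => by ext i; fin_cases i <;> simp }

theorem rotation₁_apply (y : E4) : rotation₁ y = !₂[y 2, y 3, -y 0, -y 1] := rfl
theorem rotation₂_apply (y : E4) : rotation₂ y = !₂[-y 3, y 2, -y 1, y 0] := rfl
theorem rotation₃_apply (y : E4) : rotation₃ y = !₂[-y 1, y 0, y 3, -y 2] := rfl

/-- The first component of the Hopf map `𝕊³ → 𝕊²`, extended to `ℝ⁴`. -/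
def height₁ (y : E4) : ℝ := 2 * (y 0 * y 3 - y 1 * y 2)

/-- The second component of the Hopf map, extended to `ℝ⁴`. -/
def height₂ (y : E4) : ℝ := 2 * (y 0 * y 2 + y 1 * y 3)

/-- The third component of the Hopf map, extended to `ℝ⁴`. -/
def height₃ (y : E4) : ℝ := y 0 * y 0 + y 1 * y 1 - y 2 * y 2 - y 3 * y 3

/-- The derivative of `height₁`. -/
def dheight₁ (y : E4) : E4 →L[ℝ] ℝ := (2 : ℝ) •
  ((y 0 • EuclideanSpace.proj 3 + y 3 • EuclideanSpace.proj 0) -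
    (y 1 • EuclideanSpace.proj 2 + y 2 • EuclideanSpace.proj 1))

/-- The derivative of `height₂`. -/
def dheight₂ (y : E4) : E4 →L[ℝ] ℝ := (2 : ℝ) •
  ((y 0 • EuclideanSpace.proj 2 + y 2 • EuclideanSpace.proj 0) +
    (y 1 • EuclideanSpace.proj 3 + y 3 • EuclideanSpace.proj 1))

/-- The derivative of `height₃`. -/
def dheight₃ (y : E4) : E4 →L[ℝ] ℝ :=
  (y 0 • EuclideanSpace.proj 0 + y 0 • EuclideanSpace.proj 0) +
    (y 1 • EuclideanSpace.proj 1 + y 1 • EuclideanSpace.proj 1) -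
    (y 2 • EuclideanSpace.proj 2 + y 2 • EuclideanSpace.proj 2) -
    (y 3 • EuclideanSpace.proj 3 + y 3 • EuclideanSpace.proj 3)

theorem hasFDerivAt_coord (i : Fin 4) (y : E4) :
    HasFDerivAt (fun y : E4 => y i) (EuclideanSpace.proj (𝕜 := ℝ) i : E4 →L[ℝ] ℝ) y :=
  (EuclideanSpace.proj (𝕜 := ℝ) i : E4 →L[ℝ] ℝ).hasFDerivAt

theorem hasFDerivAt_height₁ (y : E4) : HasFDerivAt height₁ (dheight₁ y) y :=
  (((hasFDerivAt_coord 0 y).mul (hasFDerivAt_coord 3 y)).sub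
    ((hasFDerivAt_coord 1 y).mul (hasFDerivAt_coord 2 y))).const_mul 2

theorem hasFDerivAt_height₂ (y : E4) : HasFDerivAt height₂ (dheight₂ y) y :=
  (((hasFDerivAt_coord 0 y).mul (hasFDerivAt_coord 2 y)).add
    ((hasFDerivAt_coord 1 y).mul (hasFDerivAt_coord 3 y))).const_mul 2

theorem hasFDerivAt_height₃ (y : E4) : HasFDerivAt height₃ (dheight₃ y) y :=
  ((((hasFDerivAt_coord 0 y).mul (hasFDerivAt_coord 0 y)).add
    ((hasFDerivAt_coord 1 y).mul (hasFDerivAt_coord 1 y))).sub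
    ((hasFDerivAt_coord 2 y).mul (hasFDerivAt_coord 2 y))).sub
    ((hasFDerivAt_coord 3 y).mul (hasFDerivAt_coord 3 y))

/-- The cubic field `a h₁ ξ₁ + b h₂ ξ₂ + c h₃ ξ₃` on `ℝ⁴`. -/
def cubicField (a b c : ℝ) (y : E4) : E4 :=
  a • height₁ y • rotation₁ y + b • height₂ y • rotation₂ y + c • height₃ y • rotation₃ y

/-- The derivative of the cubic field. -/
def dcubicField (a b c : ℝ) (y : E4) : E4 →L[ℝ] E4 :=
  a • (height₁ y • rotation₁ + (dheight₁ y).smulRight (rotation₁ y)) +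
    b • (height₂ y • rotation₂ + (dheight₂ y).smulRight (rotation₂ y)) +
    c • (height₃ y • rotation₃ + (dheight₃ y).smulRight (rotation₃ y))

theorem hasFDerivAt_cubicField (a b c : ℝ) (y : E4) :
    HasFDerivAt (cubicField a b c) (dcubicField a b c y) y :=
  ((((hasFDerivAt_height₁ y).smul rotation₁.hasFDerivAt).const_smul a).add
    (((hasFDerivAt_height₂ y).smul rotation₂.hasFDerivAt).const_smul b)).add
    (((hasFDerivAt_height₃ y).smul rotation₃.hasFDerivAt).const_smul c)

/-- The quartic function `a h₁² + b h₂² + c h₃²` on `ℝ⁴`. -/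
def quartic (a b c : ℝ) (y : E4) : ℝ :=
  a * (height₁ y * height₁ y) + b * (height₂ y * height₂ y) + c * (height₃ y * height₃ y)

/-- The derivative of the quartic function. -/
def dquartic (a b c : ℝ) (y : E4) : E4 →L[ℝ] ℝ :=
  a • (height₁ y • dheight₁ y + height₁ y • dheight₁ y) +
    b • (height₂ y • dheight₂ y + height₂ y • dheight₂ y) +
    c • (height₃ y • dheight₃ y + height₃ y • dheight₃ y)

theorem hasFDerivAt_quartic (a b c : ℝ) (y : E4) :
    HasFDerivAt (quartic a b c) (dquartic a b c y) y :=
  ((((hasFDerivAt_height₁ y).mul (hasFDerivAt_height₁ y)).const_mul a).add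
    (((hasFDerivAt_height₂ y).mul (hasFDerivAt_height₂ y)).const_mul b)).add
    (((hasFDerivAt_height₃ y).mul (hasFDerivAt_height₃ y)).const_mul c)

theorem contDiff_coord (i : Fin 4) : ContDiff ℝ ∞ fun y : E4 => y i :=
  (EuclideanSpace.proj (𝕜 := ℝ) i : E4 →L[ℝ] ℝ).contDiff

theorem contDiff_height₁ : ContDiff ℝ ∞ height₁ :=
  contDiff_const.mul (((contDiff_coord 0).mul (contDiff_coord 3)).sub
    ((contDiff_coord 1).mul (contDiff_coord 2)))

theorem contDiff_height₂ : ContDiff ℝ ∞ height₂ :=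
  contDiff_const.mul (((contDiff_coord 0).mul (contDiff_coord 2)).add
    ((contDiff_coord 1).mul (contDiff_coord 3)))

theorem contDiff_height₃ : ContDiff ℝ ∞ height₃ :=
  ((((contDiff_coord 0).mul (contDiff_coord 0)).add
    ((contDiff_coord 1).mul (contDiff_coord 1))).sub
    ((contDiff_coord 2).mul (contDiff_coord 2))).sub
    ((contDiff_coord 3).mul (contDiff_coord 3))

theorem contDiff_cubicField (a b c : ℝ) : ContDiff ℝ ∞ (cubicField a b c) :=
  (((contDiff_height₁.smul rotation₁.contDiff).const_smul a).add
    ((contDiff_height₂.smul rotation₂.contDiff).const_smul b)).add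
    ((contDiff_height₃.smul rotation₃.contDiff).const_smul c)

theorem contDiff_quartic (a b c : ℝ) : ContDiff ℝ ∞ (quartic a b c) :=
  ((contDiff_const.mul (contDiff_height₁.mul contDiff_height₁)).add
    (contDiff_const.mul (contDiff_height₂.mul contDiff_height₂))).add
    (contDiff_const.mul (contDiff_height₃.mul contDiff_height₃))

/-! ### Euler and Beltrami equations of the cubic fields. -/

theorem inner_eq_coord (y z : E4) :
    inner ℝ y z = y 0 * z 0 + y 1 * z 1 + y 2 * z 2 + y 3 * z 3 := by
  simp [PiLp.inner_apply, Fin.sum_univ_four, mul_comm]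

theorem coord_sq_sum (x : S3) : (x : E4) 0 * (x : E4) 0 + (x : E4) 1 * (x : E4) 1 +
    (x : E4) 2 * (x : E4) 2 + (x : E4) 3 * (x : E4) 3 = 1 := by
  rw [← inner_eq_coord, real_inner_self_eq_norm_sq, norm_coe, one_pow]

theorem cubicField_apply (a b c : ℝ) (y : E4) : cubicField a b c y =
    !₂[a * height₁ y * y 2 - b * height₂ y * y 3 - c * height₃ y * y 1,
      a * height₁ y * y 3 + b * height₂ y * y 2 + c * height₃ y * y 0,
      -(a * height₁ y * y 0) - b * height₂ y * y 1 + c * height₃ y * y 3,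
      -(a * height₁ y * y 1) + b * height₂ y * y 0 - c * height₃ y * y 2] := by
  ext i
  fin_cases i <;> simp [cubicField, rotation₁_apply, rotation₂_apply, rotation₃_apply] <;> ring

theorem inner_self_cubicField (a b c : ℝ) (y : E4) : inner ℝ y (cubicField a b c y) = 0 := by
  rw [inner_eq_coord, cubicField_apply]
  simp
  ring

/-- The three linear fields are orthonormal on the sphere. -/
theorem normSq_cubicField (a b c : ℝ) (x : S3) :
    ‖cubicField a b c x‖ ^ 2 = quartic (a ^ 2) (b ^ 2) (c ^ 2) x := by
  rw [← real_inner_self_eq_norm_sq, inner_eq_coord, cubicField_apply]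
  simp [quartic]
  linear_combination (a ^ 2 * height₁ x ^ 2 + b ^ 2 * height₂ x ^ 2 + c ^ 2 * height₃ x ^ 2) *
    coord_sq_sum x

theorem dheight₁_apply (y v : E4) :
    dheight₁ y v = 2 * (y 0 * v 3 + y 3 * v 0 - (y 1 * v 2 + y 2 * v 1)) := by
  simp [dheight₁]

theorem dheight₂_apply (y v : E4) :
    dheight₂ y v = 2 * (y 0 * v 2 + y 2 * v 0 + (y 1 * v 3 + y 3 * v 1)) := by
  simp [dheight₂]
  ring

theorem dheight₃_apply (y v : E4) :
    dheight₃ y v = 2 * (y 0 * v 0 + y 1 * v 1 - y 2 * v 2 - y 3 * v 3) := by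
  simp [dheight₃]
  ring

theorem dcubicField_apply (a b c : ℝ) (y v : E4) : dcubicField a b c y v =
    !₂[a * (height₁ y * v 2 + dheight₁ y v * y 2) - b * (height₂ y * v 3 + dheight₂ y v * y 3) -
        c * (height₃ y * v 1 + dheight₃ y v * y 1),
      a * (height₁ y * v 3 + dheight₁ y v * y 3) + b * (height₂ y * v 2 + dheight₂ y v * y 2) +
        c * (height₃ y * v 0 + dheight₃ y v * y 0),
      -(a * (height₁ y * v 0 + dheight₁ y v * y 0)) - b * (height₂ y * v 1 + dheight₂ y v * y 1) +
        c * (height₃ y * v 3 + dheight₃ y v * y 3),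
      -(a * (height₁ y * v 1 + dheight₁ y v * y 1)) + b * (height₂ y * v 0 + dheight₂ y v * y 0) -
        c * (height₃ y * v 2 + dheight₃ y v * y 2)] := by
  ext i
  fin_cases i <;> simp [dcubicField, rotation₁_apply, rotation₂_apply, rotation₃_apply] <;> ring

theorem dquartic_apply (a b c : ℝ) (y v : E4) : dquartic a b c y v =
    2 * (a * height₁ y * dheight₁ y v + b * height₂ y * dheight₂ y v +
      c * height₃ y * dheight₃ y v) := by
  simp [dquartic]
  ring

/-- The steady Euler equation of the cubic field, in homogeneous form on `ℝ⁴`. -/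
theorem euler_identity (a b c : ℝ) (y v : E4) :
    2 * inner ℝ (dcubicField a b c y (cubicField a b c y)) v +
      inner ℝ y y * dquartic (a * (b + c)) (b * (a + c)) (c * (a + b)) y v =
    2 * (2 * quartic (a * (b + c)) (b * (a + c)) (c * (a + b)) y -
      quartic (a ^ 2) (b ^ 2) (c ^ 2) y) * inner ℝ y v := by
  simp only [inner_eq_coord, dcubicField_apply, cubicField_apply, dquartic_apply, dheight₁_apply,
    dheight₂_apply, dheight₃_apply, quartic, height₁, height₂, height₃]
  simp
  ring
-- Euler's relation for a field homogeneous of degree 3.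
theorem dcubicField_self (a b c : ℝ) (y : E4) :
    dcubicField a b c y y = (3 : ℝ) • cubicField a b c y := by
  rw [dcubicField_apply, cubicField_apply, dheight₁_apply, dheight₂_apply, dheight₃_apply]
  ext i
  fin_cases i <;> simp [height₁, height₂, height₃] <;> ring

/-- This is the derivative of the tangency relation `inner_self_cubicField`. -/
theorem inner_self_dcubicField (a b c : ℝ) (y v : E4) :
    inner ℝ y (dcubicField a b c y v) = -inner ℝ (cubicField a b c y) v := by
  simp only [inner_eq_coord, dcubicField_apply, cubicField_apply]
  simp
  ring

/-- The first correction removes the radial part of v by homogeneity, the second the normal part of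
the value. -/
theorem covDeriv_cubicField (a b c : ℝ) (x : S3) (v : E4) :
    covDeriv (fun y : S3 => cubicField a b c y) x v = dcubicField a b c x v -
      (3 * inner ℝ (x : E4) v) • cubicField a b c x + inner ℝ (cubicField a b c x) v • (x : E4) := by
  rw [covDeriv, differential_comp_coe (hasFDerivAt_cubicField a b c x)]
  simp only [ContinuousLinearMap.comp_apply, tanProj_apply x v, map_sub, map_smul,
    dcubicField_self, tanProj_eq_self (inner_self_cubicField a b c x)]
  rw [tanProj_apply, inner_self_dcubicField]
  module

theorem isVectorField_cubicField (a b c : ℝ) :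
    IsVectorField fun x : S3 => cubicField a b c x :=
  ⟨(contDiff_cubicField a b c).contMDiff.comp contMDiff_coe_sphere,
    fun x => inner_self_cubicField a b c x⟩

theorem divergence_cubicField (a b c : ℝ) (x : S3) :
    divergence (fun y : S3 => cubicField a b c y) x = 0 := by
  rw [divergence, LinearMap.trace_eq_sum_inner _ (EuclideanSpace.basisFun (Fin 4) ℝ),
    Fin.sum_univ_four]
  simp only [ContinuousLinearMap.coe_coe, covDeriv_cubicField]
  simp only [EuclideanSpace.basisFun_apply, inner_eq_coord, dcubicField_apply, cubicField_apply,
    dheight₁_apply, dheight₂_apply, dheight₃_apply, height₁, height₂, height₃]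
  simp
  ring

theorem cross_apply (x : S3) (v w : E4) : cross x v w =
    !₂[-((x : E4) 1 * (v 2 * w 3 - v 3 * w 2) - (x : E4) 2 * (v 1 * w 3 - v 3 * w 1) +
        (x : E4) 3 * (v 1 * w 2 - v 2 * w 1)),
      (x : E4) 0 * (v 2 * w 3 - v 3 * w 2) - (x : E4) 2 * (v 0 * w 3 - v 3 * w 0) +
        (x : E4) 3 * (v 0 * w 2 - v 2 * w 0),
      -((x : E4) 0 * (v 1 * w 3 - v 3 * w 1) - (x : E4) 1 * (v 0 * w 3 - v 3 * w 0) +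
        (x : E4) 3 * (v 0 * w 1 - v 1 * w 0)),
      (x : E4) 0 * (v 1 * w 2 - v 2 * w 1) - (x : E4) 1 * (v 0 * w 2 - v 2 * w 0) +
        (x : E4) 2 * (v 0 * w 1 - v 1 * w 0)] := by
  ext i
  fin_cases i <;>
    simp [cross, Matrix.det_succ_row_zero, Fin.sum_univ_succ, Fin.succAbove, Pi.single_apply] <;> ring

/-- Both correction terms of `covDeriv_cubicField` contribute x × (·) or (·) × x, which vanish; a
homogeneous cubic identity is left, valid without |x| = 1. -/
theorem curl_cubicField (a b : ℝ) (x : S3) :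
    curl (fun y : S3 => cubicField a b (-a - b) y) x = (-4 : ℝ) • cubicField a b (-a - b) x := by
  simp only [curl, Fin.sum_univ_four, covDeriv_cubicField]
  simp only [cross_apply, inner_eq_coord, dcubicField_apply, cubicField_apply, dheight₁_apply,
    dheight₂_apply, dheight₃_apply, height₁, height₂, height₃]
  ext i
  fin_cases i <;> simp <;> ring

theorem isBeltrami_cubicField (a b : ℝ) :
    IsBeltrami fun x : S3 => cubicField a b (-a - b) x :=
  ⟨isVectorField_cubicField _ _ _, divergence_cubicField _ _ _, fun _ => -4, contMDiff_const,
    curl_cubicField a b⟩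

/-- The pressure of the cubic field. -/
def cubicPressure (a b c : ℝ) (x : S3) : ℝ :=
  (1 / 2 : ℝ) * quartic (a * (b + c)) (b * (a + c)) (c * (a + b)) x

theorem isSteadyEuler_cubicField (a b c : ℝ) :
    IsSteadyEuler (fun x : S3 => cubicField a b c x) (cubicPressure a b c) := by
  refine ⟨isVectorField_cubicField a b c, ?_, fun x => ?_, divergence_cubicField a b c⟩
  · exact (contDiff_const.mul (contDiff_quartic _ _ _)).contMDiff.comp contMDiff_coe_sphere
  · refine ext_inner_right ℝ fun v => ?_
    have hp := differential_comp_coe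
      ((hasFDerivAt_quartic (a * (b + c)) (b * (a + c)) (c * (a + b)) (x : E4)).const_mul (1 / 2))
    have hp' : differential (cubicPressure a b c) x = _ := hp
    rw [covDeriv, ContinuousLinearMap.comp_apply, inner_tanProj_left,
      differential_comp_coe (hasFDerivAt_cubicField a b c x), inner_neg_left, grad,
      InnerProductSpace.toDual_symm_apply, hp', ContinuousLinearMap.comp_apply,
      ContinuousLinearMap.comp_apply, tanProj_eq_self (inner_self_cubicField a b c x)]
    -- For a tangent vector the right-hand side vanishes, leaving the Euler equation.
    have h := euler_identity a b c x (tanProj x v)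
    rw [inner_tanProj, real_inner_self_eq_norm_sq, norm_coe] at h
    simp only [smul_apply, smul_eq_mul]
    linarith

/-! ### Bernoulli functions, and which cubic fields are KKPS. -/

/-- The coefficients add up as a(b+c) + a² = a(a+b+c), and cyclically. -/
theorem bernoulli_cubicField (a b c : ℝ) (x : S3) :
    bernoulli (fun x : S3 => cubicField a b c x) (cubicPressure a b c) x =
      (a + b + c) / 2 * quartic a b c x := by
  rw [bernoulli, normSq_cubicField, cubicPressure]
  simp only [quartic]
  ring

theorem not_isConstant_bernoulli_cubicField {a b c : ℝ} (hs : a + b + c ≠ 0) (hbc : b ≠ c) :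
    ¬ IsConstant (bernoulli (fun x : S3 => cubicField a b c x) (cubicPressure a b c)) := by
  rintro ⟨C, hC⟩
  -- Here (h₁, h₂, h₃) = (0, 0, 1); at the next point it is (0, 24/25, -7/25), so comparison
  -- isolates b - c.
  have h1 := hC ⟨!₂[1, 0, 0, 0], by simp [EuclideanSpace.norm_eq, Fin.sum_univ_four]⟩
  have h2 := hC ⟨!₂[3 / 5, 0, 4 / 5, 0], by
    simp [EuclideanSpace.norm_eq, Fin.sum_univ_four]; norm_num⟩
  rw [bernoulli_cubicField] at h1 h2
  simp [quartic, height₁, height₂, height₃] at h1 h2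
  have h3 : (a + b + c) * (b - c) = 0 := by linarith
  exact (mul_ne_zero hs (sub_ne_zero.2 hbc)) h3

theorem isConstant_bernoulli_cubicField (a b : ℝ) :
    IsConstant (bernoulli (fun x : S3 => cubicField a b (-a - b) x)
      (cubicPressure a b (-a - b))) := by
  refine ⟨0, fun x => ?_⟩
  rw [bernoulli_cubicField]
  ring

/-- Since ∑ hᵢ ξᵢ = ξ, the field equals a ξ + (c - a) h₃ ξ', and h₃ = 2 cos² s - 1. -/
theorem isKKPS_cubicField (a c : ℝ) : IsKKPS fun x : S3 => cubicField a a c x := by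
  refine ⟨fun _ => a, fun t => (c - a) * (2 * t - 1), contDiff_const, by fun_prop, fun x => ?_⟩
  have h := coord_sq_sum x
  have hq : 2 * cosSq x - 1 = height₃ x := by
    simp only [cosSq, height₃]
    linear_combination h
  simp only [hq, cubicField_apply]
  ext i
  fin_cases i <;> simp [hopf, antiHopf, height₁, height₂, height₃]
  · linear_combination (-a * (x : E4) 1) * h
  · linear_combination (a * (x : E4) 0) * h
  · linear_combination (-a * (x : E4) 3) * h
  · linear_combination (a * (x : E4) 2) * h

theorem not_related_isKKPS_cubicField {a b c : ℝ} (hab : a ≠ b) (hbc : b ≠ c) (hac : a ≠ c) :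
    ¬ ∃ v : S3 → E4, IsKKPS v ∧ IsometricallyRelated (fun x : S3 => cubicField a b c x) v := by
  rintro ⟨v, hv, hr⟩
  -- Any point with h₁h₂h₃ ≠ 0 would do; here (h₁, h₂, h₃) = (12/25, 16/25, -3/5).
  have h := differential_normSq_eq_zero (fun x => inner_self_cubicField a b c x) hv hr
    ⟨!₂[2 / 5, 1 / 5, 2 / 5, 4 / 5], by simp [EuclideanSpace.norm_eq, Fin.sum_univ_four]; norm_num⟩
  simp only [normSq_cubicField] at h
  rw [differential_comp_coe (hasFDerivAt_quartic (a ^ 2) (b ^ 2) (c ^ 2) _),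
    ContinuousLinearMap.comp_apply, tanProj_eq_self (inner_self_cubicField a b c _),
    dquartic_apply, dheight₁_apply, dheight₂_apply, dheight₃_apply, cubicField_apply] at h
  simp [height₁, height₂, height₃] at h
  have h' : (a - b) * (b - c) * (a - c) = 0 := by
    ring_nf at h ⊢
    linarith
  exact mul_ne_zero (mul_ne_zero (sub_ne_zero.2 hab) (sub_ne_zero.2 hbc)) (sub_ne_zero.2 hac) h'

theorem radiallySmooth_cubicField (a b c : ℝ) :
    RadiallySmooth fun x : S3 => cubicField a b c x := fun y hy =>
  (contDiff_cubicField a b c).contDiffAt.comp y (contDiffAt_coe_retract hy)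

theorem cubicField_sub (a b c a' b' c' δ : ℝ) :
    ((fun x : S3 => cubicField (a + δ * a') (b + δ * b') (c + δ * c') x) -
      fun x : S3 => cubicField a b c x) = δ • fun x : S3 => cubicField a' b' c' x := by
  funext x
  simp only [Pi.sub_apply, Pi.smul_apply, cubicField]
  module

end S3
end

theorem mainTheorem1 :
    -- steady Euler fields with non-constant Bernoulli function
    (∃ (u₀ : S3 → E4) (p₀ : S3 → ℝ), S3.IsKKPS u₀ ∧ S3.IsSteadyEuler u₀ p₀ ∧
      ¬ S3.IsConstant (S3.bernoulli u₀ p₀) ∧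
      ∀ (k : ℕ) (ε : ℝ), 0 < ε →
        ∃ (u : S3 → E4) (p : S3 → ℝ), S3.IsSteadyEuler u p ∧
          ¬ S3.IsConstant (S3.bernoulli u p) ∧
          S3.ckNorm k (u - u₀) < ENNReal.ofReal ε ∧
          ¬ ∃ v : S3 → E4, S3.IsKKPS v ∧ S3.IsometricallyRelated u v) ∧
    -- Beltrami fields
    (∃ u₀ : S3 → E4, S3.IsKKPS u₀ ∧ S3.IsBeltrami u₀ ∧ u₀ ≠ 0 ∧
      ∀ (k : ℕ) (ε : ℝ), 0 < ε →
        ∃ (u : S3 → E4) (p : S3 → ℝ), S3.IsBeltrami u ∧ S3.IsSteadyEuler u p ∧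
          S3.IsConstant (S3.bernoulli u p) ∧
          S3.ckNorm k (u - u₀) < ENNReal.ofReal ε ∧
          ¬ ∃ v : S3 → E4, S3.IsKKPS v ∧ S3.IsometricallyRelated u v) := by
  constructor
  · refine ⟨fun x => S3.cubicField 0 0 1 x, S3.cubicPressure 0 0 1, S3.isKKPS_cubicField 0 1,
      S3.isSteadyEuler_cubicField 0 0 1,
      S3.not_isConstant_bernoulli_cubicField (by norm_num) (by norm_num), fun k ε hε => ?_⟩
    obtain ⟨δ, hδ0, hδ1, hδ⟩ :=
      S3.exists_pos_ckNorm_smul_lt (S3.radiallySmooth_cubicField 1 0 0) k hε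
    -- The parameters are (δ, 0, 1), left unsimplified to match `cubicField_sub`.
    refine ⟨fun x => S3.cubicField (0 + δ * 1) (0 + δ * 0) (1 + δ * 0) x, _,
      S3.isSteadyEuler_cubicField _ _ _,
      S3.not_isConstant_bernoulli_cubicField (by linarith) (by simp), ?_,
      S3.not_related_isKKPS_cubicField (by simpa using hδ0.ne') (by simp) (by simpa using hδ1.ne)⟩
    rwa [S3.cubicField_sub]
  · have hs : ∀ δ : ℝ, -(-1 + δ * 1) - (-1 + δ * -1) = 2 + δ * 0 := fun δ => by ring
    have h2 : (-(-1) - (-1) : ℝ) = 2 := by norm_num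
    refine ⟨fun x => S3.cubicField (-1) (-1) 2 x, S3.isKKPS_cubicField (-1) 2,
      h2 ▸ S3.isBeltrami_cubicField (-1) (-1), fun h => ?_, fun k ε hε => ?_⟩
    -- At this point the field is (0, 2, 0, 0).
    · have h0 := congrArg (fun v : E4 => v 1)
        (congrFun h ⟨!₂[1, 0, 0, 0], by simp [EuclideanSpace.norm_eq, Fin.sum_univ_four]⟩)
      simp [S3.cubicField_apply, S3.height₁, S3.height₂, S3.height₃] at h0
    -- The direction (1, -1, 0) separates the two equal parameters and keeps their total zero, so
    -- the field stays Beltrami.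
    · obtain ⟨δ, hδ0, hδ1, hδ⟩ :=
        S3.exists_pos_ckNorm_smul_lt (S3.radiallySmooth_cubicField 1 (-1) 0) k hε
      refine ⟨fun x => S3.cubicField (-1 + δ * 1) (-1 + δ * -1) (2 + δ * 0) x, _,
        hs δ ▸ S3.isBeltrami_cubicField _ _, S3.isSteadyEuler_cubicField _ _ _,
        hs δ ▸ S3.isConstant_bernoulli_cubicField _ _, ?_,
        S3.not_related_isKKPS_cubicField (fun h => ?_) (fun h => ?_) (fun h => ?_)⟩
      · rwa [S3.cubicField_sub]
      all_goals linarith
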